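/- Let $\mathbb K$ be an algebraically closed field, let $G$ be an affine algebraic group over $\mathbb K$, and let $H$ be an observable subgroup of $G$, i.e. a closed subgroup such that the homogeneous space $G/H$ of left cosets is a quasi-affine variety. Let $p\colon G\to G/H$ be the projection, and identify $\mathbb K[G/H]$ via $p^*$ with the algebra $\mathbb K[G]^{H_r}$ of those $f\in\mathbb K[G]$ with $f(gh)=f(g)$ for all $g\in G$, $h\in H$. The group $G$ acts on $\mathbb K[G]^{H_r}$ by left translations, $(gf)(x)=f(g^{-1}x)$; an ideal stable under this action is called $G_l$-invariant. For an open embedding $G/H\hookrightarrow X$ into an affine variety $X$ let $I(X\setminus (G/H))\subseteq \mathbb K[X]$ be the ideal of functions vanishing on $X\setminus (G/H)$. Let $\mathcal I(G/H)\subseteq\mathbb K[G/H]=\mathbb K[G]^{H_r}$ be the radical of the ideal generated by the restrictions to $G/H$ of the elements of $I(X\setminus (G/H))$, for some such $X$. Then: 1. $\mathcal I(G/H)$ does not depend on the choice of the affine embedding: for every open embedding $G/H\hookrightarrow X$ into an affine variety, $\mathcal I(G/H)$ is the radical of the ideal of $\mathbb K[G]^{H_r}$ generated by $I(X\setminus (G/H))$.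 2. $\mathcal I(G/H)$ is the smallest non-zero radical $G_l$-invariant ideal of $\mathbb K[G]^{H_r}$: it is non-zero, radical and $G_l$-invariant, and it is contained in every non-zero radical $G_l$-invariant ideal of $\mathbb K[G]^{H_r}$. (The unit ideal counts as a radical ideal; $\mathbb K[G]^{H_r}$ is not assumed to be finitely generated.) -/

import Mathlib

open scoped Topology

universe u v w

/-- A space with functions over `K`: a topological space together with a sheaf of algebras of
`K`-valued functions.  `RegularOn U f` says that the restriction of `f` to the open set `U` is a
section over `U`; values of `f` outside `U` are irrelevant (`congr`). -/
structure SpaceWithFunctions (K : Type u) [Field K] (X : Type v) where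
  /-- the underlying topology -/
  topology : TopologicalSpace X
  /-- `f` restricts to a regular function on `U` -/
  RegularOn : Set X → (X → K) → Prop
  congr : ∀ U f f', IsOpen[topology] U → (∀ x ∈ U, f x = f' x) → RegularOn U f → RegularOn U f'
  const : ∀ U (c : K), IsOpen[topology] U → RegularOn U (fun _ => c)
  add : ∀ U f f', IsOpen[topology] U → RegularOn U f → RegularOn U f' → RegularOn U (f + f')
  mul : ∀ U f f', IsOpen[topology] U → RegularOn U f → RegularOn U f' → RegularOn U (f * f')
  restrict : ∀ U V f, IsOpen[topology] U → IsOpen[topology] V → V ⊆ U →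
    RegularOn U f → RegularOn V f
  glue : ∀ U f, IsOpen[topology] U →
    (∀ x ∈ U, ∃ V, IsOpen[topology] V ∧ x ∈ V ∧ V ⊆ U ∧ RegularOn V f) → RegularOn U f

/-- An affine variety over `K` (not necessarily irreducible), given by its set of points `X` and
its algebra `K[X]` of regular functions: a finitely generated algebra of `K`-valued functions on
`X` such that the points of `X` are exactly the `K`-algebra homomorphisms `K[X] → K`. -/
class AffineVariety (K : Type u) [Field K] (X : Type v) where
  /-- the algebra `K[X]` -/
  ring : Subalgebra K (X → K)
  fg : ring.FG
  eval_bijective : Function.Bijective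
    (fun x : X => ((Pi.evalAlgHom K (fun _ : X => K) x).comp ring.val : ring →ₐ[K] K))

namespace AffineVariety

/-- The algebra `K[X]` of an affine variety `X`. -/
abbrev coordinateRing (K : Type u) [Field K] (X : Type v) [AffineVariety K X] :
    Subalgebra K (X → K) := ring

/-- A map of affine varieties is a morphism if it pulls regular functions back to regular
functions. -/
def IsMorphism (K : Type u) [Field K] {X : Type v} {Y : Type w} [AffineVariety K X]
    [AffineVariety K Y] (φ : X → Y) : Prop :=
  ∀ f ∈ coordinateRing K Y, f ∘ φ ∈ coordinateRing K X

/-- Pullback of functions along a map of sets. -/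
def comapFun (K : Type u) [Field K] {X : Type v} {Y : Type w} (φ : X → Y) :
    (Y → K) →ₐ[K] (X → K) where
  toFun f := f ∘ φ
  map_one' := rfl
  map_mul' _ _ := rfl
  map_zero' := rfl
  map_add' _ _ := rfl
  commutes' _ := rfl

/-- The product of two affine varieties: its algebra of functions is generated by the functions
`(x, y) ↦ a x` and `(x, y) ↦ b y` with `a ∈ K[X]`, `b ∈ K[Y]`. -/
instance prod (K : Type u) [Field K] (X : Type v) (Y : Type w) [AffineVariety K X]
    [AffineVariety K Y] : AffineVariety K (X × Y) where
  ring := (coordinateRing K X).map (comapFun K Prod.fst) ⊔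
    (coordinateRing K Y).map (comapFun K Prod.snd)
  fg := ((fg (K := K) (X := X)).map _).sup ((fg (K := K) (X := Y)).map _)
  eval_bijective := by
    constructor
    · rintro ⟨x, y⟩ ⟨x', y'⟩ h
      have hx : x = x' := eval_bijective.1 (AlgHom.ext fun (a : coordinateRing K X) => DFunLike.congr_fun h
        ⟨comapFun K (Prod.fst : X × Y → X) a, Algebra.mem_sup_left ⟨a, a.2, rfl⟩⟩)
      have hy : y = y' := eval_bijective.1 (AlgHom.ext fun (b : coordinateRing K Y) => DFunLike.congr_fun h
        ⟨comapFun K (Prod.snd : X × Y → Y) b, Algebra.mem_sup_right ⟨b, b.2, rfl⟩⟩)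
      rw [hx, hy]
    · intro χ
      obtain ⟨x, hx⟩ := eval_bijective.2 (χ.comp
        (((comapFun K (Prod.fst : X × Y → X)).comp (coordinateRing K X).val).codRestrict _
          fun a => Algebra.mem_sup_left ⟨a, a.2, rfl⟩))
      obtain ⟨y, hy⟩ := eval_bijective.2 (χ.comp
        (((comapFun K (Prod.snd : X × Y → Y)).comp (coordinateRing K Y).val).codRestrict _
          fun b => Algebra.mem_sup_right ⟨b, b.2, rfl⟩))
      refine ⟨(x, y), AlgHom.ext ?_⟩
      rintro ⟨f, hf⟩
      change f (x, y) = χ ⟨f, hf⟩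
      induction hf using Algebra.adjoin_induction with
      | mem f hf =>
        rcases hf with ⟨a, ha, rfl⟩ | ⟨b, hb, rfl⟩
        · exact DFunLike.congr_fun hx ⟨a, ha⟩
        · exact DFunLike.congr_fun hy ⟨b, hb⟩
      | algebraMap c => exact (χ.commutes c).symm
      | add f f' hf hf' h h' =>
        rw [Pi.add_apply, h, h', ← map_add]
        rfl
      | mul f f' hf hf' h h' =>
        rw [Pi.mul_apply, h, h', ← map_mul]
        rfl

/-- Restriction of a function on `X × Y` to a slice `{x} × Y`. -/
theorem slice_mem (K : Type u) [Field K] {X : Type v} {Y : Type w} [AffineVariety K X]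
    [AffineVariety K Y] (x : X) {f : X × Y → K} (hf : f ∈ coordinateRing K (X × Y)) :
    (fun y => f (x, y)) ∈ coordinateRing K Y := by
  have h : coordinateRing K (X × Y) ≤
      (coordinateRing K Y).comap (comapFun K (fun y : Y => (x, y))) := by
    refine sup_le ?_ ?_
    · rintro _ ⟨a, -, rfl⟩
      exact (coordinateRing K Y).algebraMap_mem (a x)
    · rintro _ ⟨b, hb, rfl⟩
      exact hb
  exact h hf

/-- The Zariski topology: the closed sets are the common zero sets of subsets of `K[X]`. -/
@[reducible] def zariski (K : Type u) [Field K] (X : Type v) [AffineVariety K X] : TopologicalSpace X :=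
  TopologicalSpace.ofClosed
    {Z | ∃ S : Set (X → K), S ⊆ coordinateRing K X ∧ Z = {x | ∀ f ∈ S, f x = 0}}
    ⟨{1}, by simp, by simp⟩
    (by
      intro A hA
      refine ⟨{f | f ∈ coordinateRing K X ∧ ∃ Z ∈ A, ∀ x ∈ Z, f x = 0}, fun f hf => hf.1, ?_⟩
      ext x
      simp only [Set.mem_sInter, Set.mem_ofPred_eq]
      constructor
      · rintro h f ⟨-, Z, hZ, hf⟩
        exact hf x (h Z hZ)
      · intro h Z hZ
        obtain ⟨S, hS, rfl⟩ := hA hZ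
        exact fun f hf => h f ⟨hS hf, _, hZ, fun x hx => hx f hf⟩)
    (by
      rintro _ ⟨S, hS, rfl⟩ _ ⟨T, hT, rfl⟩
      refine ⟨{f | ∃ a ∈ S, ∃ b ∈ T, f = a * b}, ?_, ?_⟩
      · rintro _ ⟨a, ha, b, hb, rfl⟩
        exact mul_mem (hS ha) (hT hb)
      · ext x
        simp only [Set.mem_union, Set.mem_ofPred_eq]
        constructor
        · rintro (h | h) _ ⟨a, ha, b, hb, rfl⟩
          · simp [h a ha]
          · simp [h b hb]
        · intro h
          by_contra! hc
          obtain ⟨⟨a, ha, ha'⟩, b, hb, hb'⟩ := hc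
          exact mul_ne_zero ha' hb' (h _ ⟨a, ha, b, hb, rfl⟩))

/-- The structure sheaf of an affine variety: a function is regular on `U` if it is locally a
quotient of two elements of `K[X]`. -/
def RegularOn (K : Type u) [Field K] {X : Type v} [AffineVariety K X] (U : Set X)
    (f : X → K) : Prop :=
  ∀ x ∈ U, ∃ V : Set X, IsOpen[zariski K X] V ∧ x ∈ V ∧ V ⊆ U ∧
    ∃ a ∈ coordinateRing K X, ∃ b ∈ coordinateRing K X, ∀ y ∈ V, b y ≠ 0 ∧ f y = a y / b y

/-- An affine variety as a space with functions. -/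
def space (K : Type u) [Field K] (X : Type v) [AffineVariety K X] : SpaceWithFunctions K X where
  topology := zariski K X
  RegularOn := RegularOn K
  congr := by
    intro U f f' _ h hf x hx
    obtain ⟨V, hV, hxV, hVU, a, ha, b, hb, H⟩ := hf x hx
    exact ⟨V, hV, hxV, hVU, a, ha, b, hb, fun y hy => ⟨(H y hy).1, by
      rw [← h y (hVU hy)]; exact (H y hy).2⟩⟩
  const := by
    intro U c hU x hx
    exact ⟨U, hU, hx, subset_rfl, algebraMap K (X → K) c, (coordinateRing K X).algebraMap_mem c,
      1, one_mem _, fun y _ => ⟨one_ne_zero, by simp⟩⟩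
  add := by
    intro U f f' _ hf hf' x hx
    obtain ⟨V, hV, hxV, hVU, a, ha, b, hb, H⟩ := hf x hx
    obtain ⟨V', hV', hxV', hVU', a', ha', b', hb', H'⟩ := hf' x hx
    refine ⟨V ∩ V', @IsOpen.inter _ (zariski K X) _ _ hV hV', ⟨hxV, hxV'⟩, Set.inter_subset_left.trans hVU,
      a * b' + b * a', add_mem (mul_mem ha hb') (mul_mem hb ha'), b * b', mul_mem hb hb', ?_⟩
    rintro y ⟨hy, hy'⟩
    refine ⟨mul_ne_zero (H y hy).1 (H' y hy').1, ?_⟩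
    simp only [Pi.add_apply, Pi.mul_apply]
    rw [(H y hy).2, (H' y hy').2, div_add_div _ _ (H y hy).1 (H' y hy').1]
  mul := by
    intro U f f' _ hf hf' x hx
    obtain ⟨V, hV, hxV, hVU, a, ha, b, hb, H⟩ := hf x hx
    obtain ⟨V', hV', hxV', hVU', a', ha', b', hb', H'⟩ := hf' x hx
    refine ⟨V ∩ V', @IsOpen.inter _ (zariski K X) _ _ hV hV', ⟨hxV, hxV'⟩, Set.inter_subset_left.trans hVU,
      a * a', mul_mem ha ha', b * b', mul_mem hb hb', ?_⟩
    rintro y ⟨hy, hy'⟩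
    refine ⟨mul_ne_zero (H y hy).1 (H' y hy').1, ?_⟩
    simp only [Pi.mul_apply]
    rw [(H y hy).2, (H' y hy').2, div_mul_div_comm]
  restrict := by
    intro U V f _ hV hVU hf x hx
    obtain ⟨W, hW, hxW, hWU, a, ha, b, hb, H⟩ := hf x (hVU hx)
    exact ⟨W ∩ V, @IsOpen.inter _ (zariski K X) _ _ hW hV, ⟨hxW, hx⟩, Set.inter_subset_right, a, ha, b, hb,
      fun y hy => H y hy.1⟩
  glue := by
    intro U f _ h x hx
    obtain ⟨V, hV, hxV, hVU, hf⟩ := h x hx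
    obtain ⟨W, hW, hxW, hWV, H⟩ := hf x hxV
    exact ⟨W, hW, hxW, hWV.trans hVU, H⟩

/-- Elements of `K[X]` are regular on every open set. -/
theorem regularOn_of_mem (K : Type u) [Field K] {X : Type v} [AffineVariety K X] {U : Set X}
    (hU : IsOpen[zariski K X] U) {f : X → K} (hf : f ∈ coordinateRing K X) :
    RegularOn K U f := fun x hx =>
  ⟨U, hU, hx, subset_rfl, f, hf, 1, one_mem _, fun y _ => ⟨one_ne_zero, by simp⟩⟩

/-- A family in `K[X]` without common zeros generates the unit ideal. -/
theorem span_eq_top (K : Type u) [Field K] [IsAlgClosed K] {X : Type v} [AffineVariety K X]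
    (S : Set (coordinateRing K X)) (hS : ∀ x, ∃ f ∈ S, (f : X → K) x ≠ 0) :
    Ideal.span S = ⊤ := by
  by_contra hne
  obtain ⟨m, hm, hle⟩ := Ideal.exists_le_maximal _ hne
  have hft : Algebra.FiniteType K (coordinateRing K X) :=
    (Subalgebra.fg_iff_finiteType _).1 fg
  let := Ideal.Quotient.field m
  have : Algebra.FiniteType K (coordinateRing K X ⧸ m) :=
    hft.of_surjective (Ideal.Quotient.mkₐ K m) Ideal.Quotient.mk_surjective
  have : Module.Finite K (coordinateRing K X ⧸ m) :=
    finite_of_finite_type_of_isJacobsonRing K _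
  have : Algebra.IsIntegral K (coordinateRing K X ⧸ m) := Algebra.IsIntegral.of_finite K _
  have hb : Function.Bijective (algebraMap K (coordinateRing K X ⧸ m)) :=
    IsAlgClosed.algebraMap_bijective_of_isIntegral
  let e : K ≃ₐ[K] (coordinateRing K X ⧸ m) :=
    AlgEquiv.ofBijective (Algebra.ofId K (coordinateRing K X ⧸ m)) hb
  obtain ⟨x, hx⟩ := eval_bijective.2 (e.symm.toAlgHom.comp (Ideal.Quotient.mkₐ K m))
  obtain ⟨f, hf, hfx⟩ := hS x
  apply hfx
  have h1 := DFunLike.congr_fun hx f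
  have h2 : Ideal.Quotient.mk m f = 0 :=
    Ideal.Quotient.eq_zero_iff_mem.2 (hle (Ideal.subset_span hf))
  have h3 : (f : X → K) x = e.symm (Ideal.Quotient.mk m f) := h1
  rw [h3, h2, map_zero]

/-- Everywhere regular functions on an affine variety are elements of `K[X]`. -/
theorem mem_of_regularOn_univ (K : Type u) [Field K] [IsAlgClosed K] {X : Type v}
    [AffineVariety K X] {f : X → K} (hf : RegularOn K Set.univ f) : f ∈ coordinateRing K X := by
  have htop : Ideal.span {d : coordinateRing K X | (d : X → K) * f ∈ coordinateRing K X} = ⊤ := by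
    apply span_eq_top
    intro x
    obtain ⟨V, ⟨S, hS, hSV⟩, hxV, -, a, ha, b, hb, H⟩ := hf x trivial
    have hx' : ∃ h ∈ S, h x ≠ 0 := by
      by_contra! hc
      have : x ∈ Vᶜ := by
        rw [hSV]
        exact hc
      exact this hxV
    obtain ⟨h, hh, hhx⟩ := hx'
    refine ⟨⟨h * b, mul_mem (hS hh) hb⟩, ?_, mul_ne_zero hhx (H x hxV).1⟩
    have heq : h * b * f = h * a := by
      funext y
      simp only [Pi.mul_apply]
      by_cases hy : y ∈ V
      · rw [(H y hy).2, mul_assoc, mul_div_cancel₀ _ (H y hy).1]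
      · have hy' : y ∈ Vᶜ := hy
        rw [hSV] at hy'
        rw [hy' h hh]
        ring
    change h * b * f ∈ coordinateRing K X
    rw [heq]
    exact mul_mem (hS hh) ha
  let J : Ideal (coordinateRing K X) :=
    { carrier := {d | (d : X → K) * f ∈ coordinateRing K X}
      zero_mem' := by
        change (0 : X → K) * f ∈ coordinateRing K X
        rw [zero_mul]
        exact zero_mem _
      add_mem' := fun {d e} hd he => by
        change ((d : X → K) + e) * f ∈ coordinateRing K X
        rw [add_mul]
        exact add_mem hd he
      smul_mem' := fun c d hd => by
        change ((c : X → K) * d) * f ∈ coordinateRing K X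
        rw [mul_assoc]
        exact mul_mem c.2 hd }
  have hJ : (1 : coordinateRing K X) ∈ J :=
    (Ideal.span_le (I := J)).2 (fun _ h => h) (htop ▸ Submodule.mem_top)
  have h1 : (1 : X → K) * f ∈ coordinateRing K X := hJ
  rwa [one_mul] at h1

/-- The ideal `I(Z)` of functions in `K[X]` vanishing on `Z ⊆ X`. -/
def vanishingIdeal (K : Type u) [Field K] {X : Type v} [AffineVariety K X] (Z : Set X) :
    Ideal (coordinateRing K X) where
  carrier := {f | ∀ z ∈ Z, (f : X → K) z = 0}
  zero_mem' := fun _ _ => rfl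
  add_mem' := fun {a b} ha hb z hz => by simp [ha z hz, hb z hz]
  smul_mem' := fun c f hf z hz => by simp [hf z hz]

end AffineVariety

namespace SpaceWithFunctions

/-- The algebra `K[X]` of everywhere regular functions on a space with functions. -/
def regularFunctions {K : Type u} [Field K] {X : Type v} (S : SpaceWithFunctions K X) :
    Subalgebra K (X → K) where
  carrier := {f | S.RegularOn Set.univ f}
  mul_mem' := fun ha hb => S.mul _ _ _ S.topology.isOpen_univ ha hb
  add_mem' := fun ha hb => S.add _ _ _ S.topology.isOpen_univ ha hb
  algebraMap_mem' := fun c => S.const _ c S.topology.isOpen_univ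

/-- `φ` is an isomorphism of the space with functions `X` onto an open subspace of `Y`. -/
structure IsOpenEmbedding {K : Type u} [Field K] {X : Type v} {Y : Type w}
    (S : SpaceWithFunctions K X) (T : SpaceWithFunctions K Y) (φ : X → Y) : Prop where
  isOpenEmbedding : @Topology.IsOpenEmbedding X Y S.topology T.topology φ
  regularOn_iff : ∀ (U : Set X) (f : Y → K), IsOpen[S.topology] U →
    (T.RegularOn (φ '' U) f ↔ S.RegularOn U (f ∘ φ))

/-- An affine embedding of `S`: an open embedding into an affine variety `Y`. -/
abbrev IsAffineEmbedding {K : Type u} [Field K] {X : Type v} (S : SpaceWithFunctions K X)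
    {Y : Type w} [AffineVariety K Y] (φ : X → Y) : Prop :=
  S.IsOpenEmbedding (AffineVariety.space K Y) φ

/-- `S` is quasi-affine: it admits an affine embedding.  (Every affine variety over `K` is
isomorphic to one whose points form a type in the universe of `K`.) -/
def IsQuasiAffine {K : Type u} [Field K] {X : Type v} (S : SpaceWithFunctions K X) : Prop :=
  ∃ (Y : Type u) (_ : AffineVariety K Y) (φ : X → Y), S.IsAffineEmbedding φ

/-- The restriction homomorphism `K[Y] → K[X]` of an affine embedding `φ : X → Y`. -/
def restrictHom {K : Type u} [Field K] {X : Type v} (S : SpaceWithFunctions K X)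
    {Y : Type w} [AffineVariety K Y] {φ : X → Y} (hφ : S.IsAffineEmbedding φ) :
    AffineVariety.coordinateRing K Y →ₐ[K] S.regularFunctions :=
  ((AffineVariety.comapFun K φ).comp (AffineVariety.coordinateRing K Y).val).codRestrict
    S.regularFunctions (fun a => (hφ.regularOn_iff Set.univ a S.topology.isOpen_univ).1
      (AffineVariety.regularOn_of_mem K
        (@Topology.IsOpenEmbedding.isOpenMap _ _ _ S.topology (AffineVariety.zariski K Y)
          hφ.isOpenEmbedding _ S.topology.isOpen_univ) a.2))

/-- The radical of the ideal of `K[X]` generated by `I(Y ∖ X)`, for an affine embedding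
`φ : X → Y`. -/
def boundaryIdealOf {K : Type u} [Field K] {X : Type v} (S : SpaceWithFunctions K X)
    {Y : Type w} [AffineVariety K Y] {φ : X → Y} (hφ : S.IsAffineEmbedding φ) :
    Ideal S.regularFunctions :=
  ((AffineVariety.vanishingIdeal K (Set.range φ)ᶜ).map (S.restrictHom hφ)).radical

/-- The boundary ideal `𝓘(X)` of a quasi-affine space: the radical of the ideal of `K[X]`
generated by `I(Y ∖ X)`, where `Y` is some (chosen) affine embedding of `X`. -/
noncomputable def boundaryIdeal {K : Type u} [Field K] {X : Type v} (S : SpaceWithFunctions K X)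
    (hS : S.IsQuasiAffine) : Ideal S.regularFunctions :=
  letI := hS.choose_spec.choose
  S.boundaryIdealOf hS.choose_spec.choose_spec.choose_spec

/-- The quotient of a space with functions by a map `p : X → Y`: the quotient topology, and
`f` is regular on `U` iff `f ∘ p` is regular on `p ⁻¹' U`. -/
def quotient {K : Type u} [Field K] {X : Type v} {Y : Type w} (S : SpaceWithFunctions K X)
    (p : X → Y) : SpaceWithFunctions K Y where
  topology := S.topology.coinduced p
  RegularOn U f := S.RegularOn (p ⁻¹' U) (f ∘ p)
  congr := fun _ _ _ hU h hf => S.congr _ _ _ hU (fun x hx => h (p x) hx) hf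
  const := fun _ c hU => S.const _ c hU
  add := fun _ _ _ hU hf hf' => S.add _ _ _ hU hf hf'
  mul := fun _ _ _ hU hf hf' => S.mul _ _ _ hU hf hf'
  restrict := fun _ _ _ hU hV hVU hf => S.restrict _ _ _ hU hV (Set.preimage_mono hVU) hf
  glue := by
    intro U f hU h
    refine S.glue _ _ hU fun x hx => ?_
    obtain ⟨V, hV, hxV, hVU, hf⟩ := h (p x) hx
    exact ⟨p ⁻¹' V, hV, hxV, Set.preimage_mono hVU, hf⟩

end SpaceWithFunctions

/-- `G` is an affine algebraic group over `K`: a group that is an affine variety and whose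
multiplication and inversion are morphisms. -/
class IsAffineAlgebraicGroup (K : Type u) [Field K] (G : Type v) [Group G]
    [AffineVariety K G] : Prop where
  mul_morphism : AffineVariety.IsMorphism K (fun x : G × G => x.1 * x.2)
  inv_morphism : AffineVariety.IsMorphism K (fun x : G => x⁻¹)

namespace AlgebraicGroup

open AffineVariety

variable (K : Type u) [Field K] {G : Type v} [Group G] [AffineVariety K G]

/-- The homogeneous space `G/H` of left cosets `gH`, as a space with functions. -/
def cosetSpace (H : Subgroup G) : SpaceWithFunctions K (G ⧸ H) :=
  (space K G).quotient (QuotientGroup.mk : G → G ⧸ H)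

/-- `H` is an observable subgroup of `G`: `H` is closed and `G/H` is quasi-affine. -/
structure IsObservable (H : Subgroup G) : Prop where
  isClosed : IsClosed[zariski K G] (H : Set G)
  isQuasiAffine : (cosetSpace K H).IsQuasiAffine

/-- The algebra `K[G]^{H_r}` of functions in `K[G]` invariant under right translations by `H`. -/
def rightInvariants (H : Subgroup G) : Subalgebra K (coordinateRing K G) where
  carrier := {f | ∀ g : G, ∀ h ∈ H, (f : G → K) (g * h) = (f : G → K) g}
  mul_mem' := fun {a b} ha hb g h hh => by simp [ha g h hh, hb g h hh]
  add_mem' := fun {a b} ha hb g h hh => by simp [ha g h hh, hb g h hh]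
  algebraMap_mem' := fun c g h hh => rfl

/-- The identification `K[G/H] ≃ K[G]^{H_r}`, `f ↦ f ∘ p`, with `p : G → G/H` the projection. -/
noncomputable def regularFunctionsEquiv [IsAlgClosed K] (H : Subgroup G) :
    (cosetSpace K H).regularFunctions ≃ₐ[K] rightInvariants K H :=
  AlgEquiv.ofBijective
    ({ toFun := fun f => ⟨⟨(f : G ⧸ H → K) ∘ QuotientGroup.mk, mem_of_regularOn_univ K f.2⟩,
        fun g h hh => congrArg (f : G ⧸ H → K) (QuotientGroup.mk_mul_of_mem g hh)⟩
       map_one' := rfl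
       map_mul' := fun _ _ => rfl
       map_zero' := rfl
       map_add' := fun _ _ => rfl
       commutes' := fun _ => rfl } :
      (cosetSpace K H).regularFunctions →ₐ[K] rightInvariants K H)
    (by
      constructor
      · intro f f' h
        apply Subtype.ext
        funext x
        obtain ⟨g, rfl⟩ := QuotientGroup.mk_surjective x
        exact congrFun (congrArg (fun a : rightInvariants K H => (a : G → K)) h) g
      · intro f
        refine ⟨⟨fun x => Quotient.liftOn' x (f : G → K) ?_, ?_⟩, rfl⟩
        · intro g g' hg
          rw [QuotientGroup.leftRel_apply] at hg
          simpa using (f.2 g _ hg).symm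
        · exact regularOn_of_mem K (zariski K G).isOpen_univ f.1.2)

/-- The boundary ideal `𝓘(G/H)` as an ideal of `K[G]^{H_r}`. -/
noncomputable def boundaryIdeal [IsAlgClosed K] (H : Subgroup G) (hH : IsObservable K H) :
    Ideal (rightInvariants K H) :=
  ((cosetSpace K H).boundaryIdeal hH.isQuasiAffine).map (regularFunctionsEquiv K H)

/-- For a map `φ : G/H → X` that is an affine embedding, the homomorphism `K[X] → K[G]^{H_r}`,
`a ↦ a ∘ φ ∘ p`. -/
noncomputable def pullback [IsAlgClosed K] (H : Subgroup G) {X : Type w} [AffineVariety K X]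
    {φ : G ⧸ H → X} (hφ : (cosetSpace K H).IsAffineEmbedding φ) :
    coordinateRing K X →ₐ[K] rightInvariants K H :=
  (regularFunctionsEquiv K H).toAlgHom.comp ((cosetSpace K H).restrictHom hφ)

/-- Left translates of functions in `K[G]` are in `K[G]`. -/
theorem leftTranslate_mem [IsAffineAlgebraicGroup K G] (g : G) {f : G → K}
    (hf : f ∈ coordinateRing K G) : (fun x => f (g⁻¹ * x)) ∈ coordinateRing K G :=
  slice_mem K g⁻¹ (IsAffineAlgebraicGroup.mul_morphism f hf)

/-- The action of `g ∈ G_l` on `K[G]^{H_r}`: `(g f)(x) = f (g⁻¹ x)`. -/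
def leftTranslate [IsAffineAlgebraicGroup K G] {H : Subgroup G} (g : G)
    (f : rightInvariants K H) : rightInvariants K H :=
  ⟨⟨fun x => (f : G → K) (g⁻¹ * x), leftTranslate_mem K g f.1.2⟩, fun x h hh => by
    simpa [mul_assoc] using f.2 (g⁻¹ * x) h hh⟩

/-- An ideal of `K[G]^{H_r}` is `G_l`-invariant if it is stable under all left translations. -/
def IsLeftInvariant [IsAffineAlgebraicGroup K G] {H : Subgroup G}
    (I : Ideal (rightInvariants K H)) : Prop :=
  ∀ (g : G), ∀ f ∈ I, leftTranslate K g f ∈ I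

end AlgebraicGroup

/-!
Write `A = K[X]` for the regular functions on a quasi-affine space `X`, and let `φ : X → Y` be an
affine embedding.  Everything follows from one comparison, `boundaryIdealOf_le_radical`: the
boundary ideal of `φ` is contained in the radical of *every* ideal `J` of `A` without common zeros
on `X`.  To see this, let `J'` be the ideal of those `e ∈ K[Y]` whose restriction to `X` lies in
`J`.  Near `φ x` an element `c ∈ J` with `c x ≠ 0` is a quotient `a / d` of elements of `K[Y]`;
multiplying by a cutoff function `h ∈ K[Y]`, which vanishes off the neighbourhood in question,
gives `h a = h d c ∈ J'`, nonzero at `φ x`.  So the zeros of `J'` lie in `Y ∖ X`, and the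
Nullstellensatz in `K[Y]` shows that every function vanishing on `Y ∖ X` lies in the radical of
`J'`.  Note that `A` itself, which need not be finitely generated, is never subjected to the
Nullstellensatz.

Conversely the boundary ideal has no common zeros on `X`, since `X` is open in `Y`
(`exists_mem_boundaryIdealOf_apply_ne_zero`).  Hence it is the least radical ideal of `A` without
common zeros on `X`, a description which does not mention `Y`; this is the independence of the
embedding.  For `X = G/H`, any translate of the boundary ideal is again a radical ideal without
common zeros, which gives invariance; and a nonzero invariant ideal has no common zeros because
`G` acts transitively on `G/H`, which gives minimality.
-/

/-! ### The Nullstellensatz for affine varieties -/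

namespace AffineVariety

/-- Hilbert's Nullstellensatz, strong form. -/
theorem mem_radical_of_forall_zeros {K : Type u} [Field K] [IsAlgClosed K] {Y : Type w}
    [AffineVariety K Y] (J : Ideal (coordinateRing K Y)) (b : coordinateRing K Y)
    (hb : ∀ y, (∀ f ∈ J, (f : Y → K) y = 0) → (b : Y → K) y = 0) : b ∈ J.radical := by
  have hft : Algebra.FiniteType K (coordinateRing K Y) :=
    (Subalgebra.fg_iff_finiteType _).1 fg
  have : IsJacobsonRing (coordinateRing K Y) :=
    isJacobsonRing_of_finiteType (A := K)
  rw [Ideal.radical_eq_jacobson, Ideal.jacobson, Ideal.mem_sInf]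
  rintro m ⟨hJm, hm⟩
  -- the maximal ideal `m` has a zero `y`, by the weak form of the Nullstellensatz
  have hzero : ∃ y, ∀ f ∈ m, (f : Y → K) y = 0 := by
    by_contra! hc
    have htop := span_eq_top K (m : Set (coordinateRing K Y)) hc
    rw [Ideal.span_eq] at htop
    exact hm.ne_top htop
  obtain ⟨y, hy⟩ := hzero
  by_contra hbm
  -- otherwise `b` is invertible modulo `m`, while it vanishes at `y`
  obtain ⟨c, d, hd, hcd⟩ := hm.exists_inv hbm
  have h := congrArg (fun f : coordinateRing K Y => (f : Y → K) y) hcd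
  have hby := hb y fun f hf => hy f (hJm hf)
  simp [hby, hy d hd] at h

/-- A cutoff function: it vanishes outside a given open neighbourhood of a point, but not at the
point. -/
theorem exists_apply_ne_zero_of_isOpen {K : Type u} [Field K] {Y : Type w} [AffineVariety K Y]
    {V : Set Y} (hV : IsOpen[zariski K Y] V) {y : Y} (hy : y ∈ V) :
    ∃ h ∈ vanishingIdeal K Vᶜ, (h : Y → K) y ≠ 0 := by
  obtain ⟨S, hS, hSV⟩ := hV
  by_contra! hc
  have : y ∈ Vᶜ := by
    rw [hSV]
    intro f hf
    refine hc ⟨f, hS hf⟩ fun z hz => ?_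
    rw [hSV] at hz
    exact hz f hf
  exact this hy

end AffineVariety

/-! ### Boundary ideals and common zeros -/

namespace SpaceWithFunctions

open AffineVariety

theorem isOpen_range_of_isAffineEmbedding {K : Type u} [Field K] {X : Type v}
    {S : SpaceWithFunctions K X} {Y : Type w} [AffineVariety K Y] {φ : X → Y}
    (hφ : S.IsAffineEmbedding φ) : IsOpen[zariski K Y] (Set.range φ) :=
  @Topology.IsOpenEmbedding.isOpen_range _ _ S.topology (zariski K Y) _ hφ.isOpenEmbedding

theorem exists_mem_boundaryIdealOf_apply_ne_zero {K : Type u} [Field K] {X : Type v}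
    {S : SpaceWithFunctions K X} {Y : Type w} [AffineVariety K Y] {φ : X → Y}
    (hφ : S.IsAffineEmbedding φ) (x : X) :
    ∃ c ∈ S.boundaryIdealOf hφ, (c : X → K) x ≠ 0 := by
  obtain ⟨h, hh, hx⟩ := exists_apply_ne_zero_of_isOpen
    (isOpen_range_of_isAffineEmbedding hφ) (Set.mem_range_self x)
  exact ⟨S.restrictHom hφ h, Ideal.le_radical (Ideal.mem_map_of_mem _ hh), hx⟩

/-- The comparison on which everything rests: the Nullstellensatz is applied in `K[Y]` to the
ideal of those functions whose restriction to `X` lies in `J`. -/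
theorem boundaryIdealOf_le_radical {K : Type u} [Field K] [IsAlgClosed K] {X : Type v}
    {S : SpaceWithFunctions K X} {Y : Type w} [AffineVariety K Y] {φ : X → Y}
    (hφ : S.IsAffineEmbedding φ) (J : Ideal S.regularFunctions)
    (hJ : ∀ x, ∃ c ∈ J, (c : X → K) x ≠ 0) : S.boundaryIdealOf hφ ≤ J.radical := by
  refine (Ideal.radical_isRadical J).radical_le_iff.2 (Ideal.map_le_iff_le_comap.2 ?_)
  intro b hb
  rw [Ideal.comap_radical]
  refine mem_radical_of_forall_zeros _ b fun y hy => hb y ?_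
  rintro ⟨x, rfl⟩
  obtain ⟨c, hcJ, hcx⟩ := hJ x
  have hinj : Function.Injective φ :=
    @Topology.IsEmbedding.injective _ _ S.topology (zariski K Y) _
      (@Topology.IsOpenEmbedding.toIsEmbedding _ _ S.topology (zariski K Y) _ hφ.isOpenEmbedding)
  have hc : (fun x => Function.extend φ (c : X → K) 0 (φ x)) = c :=
    funext fun x => hinj.extend_apply _ _ x
  -- `c`, extended to `Y` by zero, is regular on the image of `X`
  have hreg : AffineVariety.RegularOn K (φ '' Set.univ) (Function.extend φ (c : X → K) 0) :=
    (hφ.regularOn_iff Set.univ _ S.topology.isOpen_univ).2 (by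
      change S.RegularOn Set.univ (fun x => Function.extend φ (c : X → K) 0 (φ x))
      rw [hc]
      exact c.2)
  obtain ⟨V, hV, hxV, -, a, ha, d, hd, H⟩ := hreg (φ x) ⟨x, trivial, rfl⟩
  obtain ⟨h, hh, hhx⟩ := exists_apply_ne_zero_of_isOpen hV hxV
  -- the numerator, cut off by `h`, restricts to a multiple of `c`
  have hmem : h * ⟨a, ha⟩ ∈ J.comap (S.restrictHom hφ) := by
    have heq : S.restrictHom hφ (h * ⟨a, ha⟩) = S.restrictHom hφ (h * ⟨d, hd⟩) * c := by
      apply Subtype.ext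
      funext z
      change (h : Y → K) (φ z) * a (φ z) = (h : Y → K) (φ z) * d (φ z) * (c : X → K) z
      by_cases hz : φ z ∈ V
      · have hz' := (H _ hz).2
        rw [hinj.extend_apply] at hz'
        rw [hz', mul_assoc, mul_div_cancel₀ _ (H _ hz).1]
      · rw [hh _ hz]
        ring
    rw [Ideal.mem_comap, heq]
    exact J.mul_mem_left _ hcJ
  have h0 : (h : Y → K) (φ x) * a (φ x) = 0 := hy _ hmem
  have hcx' := (H _ hxV).2
  rw [hinj.extend_apply, (mul_eq_zero.1 h0).resolve_left hhx, zero_div] at hcx'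
  exact hcx hcx'

/-- The boundary ideal is the least radical ideal without common zeros, hence does not depend on
the affine embedding. -/
theorem boundaryIdealOf_eq {K : Type u} [Field K] [IsAlgClosed K] {X : Type v}
    {S : SpaceWithFunctions K X} {Y : Type w} [AffineVariety K Y] {φ : X → Y}
    (hφ : S.IsAffineEmbedding φ) {Y' : Type*} [AffineVariety K Y'] {φ' : X → Y'}
    (hφ' : S.IsAffineEmbedding φ') : S.boundaryIdealOf hφ = S.boundaryIdealOf hφ' := by
  apply le_antisymm
  · refine (boundaryIdealOf_le_radical hφ _
      (exists_mem_boundaryIdealOf_apply_ne_zero hφ')).trans_eq ?_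
    exact Ideal.radical_idem _
  · refine (boundaryIdealOf_le_radical hφ' _
      (exists_mem_boundaryIdealOf_apply_ne_zero hφ)).trans_eq ?_
    exact Ideal.radical_idem _

theorem boundaryIdeal_eq_boundaryIdealOf {K : Type u} [Field K] [IsAlgClosed K] {X : Type v}
    {S : SpaceWithFunctions K X} (hS : S.IsQuasiAffine) {Y : Type w} [AffineVariety K Y]
    {φ : X → Y} (hφ : S.IsAffineEmbedding φ) : S.boundaryIdeal hS = S.boundaryIdealOf hφ :=
  letI := hS.choose_spec.choose
  boundaryIdealOf_eq hS.choose_spec.choose_spec.choose_spec hφ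

end SpaceWithFunctions

/-! ### Homogeneous spaces -/

theorem Ideal.map_radical_map_algEquiv {K R A B : Type*} [CommSemiring K] [CommSemiring R]
    [CommSemiring A] [CommSemiring B] [Algebra K R] [Algebra K A] [Algebra K B] (e : A ≃ₐ[K] B)
    (r : R →ₐ[K] A) (I : Ideal R) :
    (I.map r).radical.map e = (I.map (e.toAlgHom.comp r)).radical := by
  have hcomap (J : Ideal A) : J.map (e : A ≃+* B) = J.comap (e : A ≃+* B).symm :=
    (Ideal.comap_symm (e : A ≃+* B)).symm
  have hmap : I.map (e.toAlgHom.comp r) = (I.map r).map (e : A ≃+* B) :=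
    (Ideal.map_map (I := I) (r : R →+* A) (e : A →+* B)).symm
  rw [hmap, hcomap]
  refine (hcomap _).trans ?_
  exact Ideal.comap_radical _ _

namespace AlgebraicGroup

open AffineVariety SpaceWithFunctions

theorem boundaryIdeal_eq_radical {K : Type u} [Field K] [IsAlgClosed K] {G : Type v} [Group G]
    [AffineVariety K G] {H : Subgroup G} (hH : IsObservable K H) {X : Type w}
    [AffineVariety K X] {φ : G ⧸ H → X} (hφ : (cosetSpace K H).IsAffineEmbedding φ) :
    boundaryIdeal K H hH =
      ((vanishingIdeal K (Set.range φ)ᶜ).map (pullback K H hφ)).radical := by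
  rw [boundaryIdeal, boundaryIdeal_eq_boundaryIdealOf hH.isQuasiAffine hφ]
  exact Ideal.map_radical_map_algEquiv (regularFunctionsEquiv K H)
    ((cosetSpace K H).restrictHom hφ) (vanishingIdeal K (Set.range φ)ᶜ)

theorem boundaryIdeal_isRadical {K : Type u} [Field K] [IsAlgClosed K] {G : Type v} [Group G]
    [AffineVariety K G] {H : Subgroup G} (hH : IsObservable K H) :
    (boundaryIdeal K H hH).IsRadical := by
  obtain ⟨Y, _, φ, hφ⟩ := hH.isQuasiAffine
  rw [boundaryIdeal_eq_radical hH hφ]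
  exact Ideal.radical_isRadical _

theorem exists_mem_boundaryIdeal_apply_ne_zero {K : Type u} [Field K] [IsAlgClosed K]
    {G : Type v} [Group G] [AffineVariety K G] {H : Subgroup G} (hH : IsObservable K H) (x : G) :
    ∃ c ∈ boundaryIdeal K H hH, (c : G → K) x ≠ 0 := by
  obtain ⟨Y, _, φ, hφ⟩ := hH.isQuasiAffine
  obtain ⟨c, hc, hx⟩ := exists_mem_boundaryIdealOf_apply_ne_zero hφ (x : G ⧸ H)
  rw [← boundaryIdeal_eq_boundaryIdealOf hH.isQuasiAffine hφ] at hc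
  exact ⟨regularFunctionsEquiv K H c, Ideal.mem_map_of_mem _ hc, hx⟩

theorem boundaryIdeal_le_of_isRadical {K : Type u} [Field K] [IsAlgClosed K]
    {G : Type v} [Group G] [AffineVariety K G] {H : Subgroup G} (hH : IsObservable K H)
    {I : Ideal (rightInvariants K H)} (hI : I.IsRadical)
    (hzero : ∀ x, ∃ c ∈ I, (c : G → K) x ≠ 0) : boundaryIdeal K H hH ≤ I := by
  obtain ⟨Y, _, φ, hφ⟩ := hH.isQuasiAffine
  rw [boundaryIdeal, boundaryIdeal_eq_boundaryIdealOf hH.isQuasiAffine hφ,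
    Ideal.map_le_iff_le_comap]
  refine (boundaryIdealOf_le_radical hφ (I.comap (regularFunctionsEquiv K H)) ?_).trans_eq
    (hI.comap _).radical
  intro x
  obtain ⟨g, rfl⟩ := QuotientGroup.mk_surjective x
  obtain ⟨c, hc, hx⟩ := hzero g
  obtain ⟨c, rfl⟩ := (regularFunctionsEquiv K H).surjective c
  exact ⟨c, hc, hx⟩

/-- Left translation by `g` as an endomorphism of the ring `K[G]^{H_r}`. -/
def leftTranslateHom {K : Type u} [Field K] {G : Type v} [Group G] [AffineVariety K G]
    [IsAffineAlgebraicGroup K G] {H : Subgroup G} (g : G) :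
    rightInvariants K H →+* rightInvariants K H where
  toFun := leftTranslate K g
  map_one' := rfl
  map_mul' _ _ := rfl
  map_zero' := rfl
  map_add' _ _ := rfl

theorem leftTranslate_apply {K : Type u} [Field K] {G : Type v} [Group G] [AffineVariety K G]
    [IsAffineAlgebraicGroup K G] {H : Subgroup G} (g : G) (f : rightInvariants K H) (x : G) :
    (leftTranslate K g f : G → K) x = (f : G → K) (g⁻¹ * x) :=
  rfl

theorem leftTranslate_leftTranslate_inv {K : Type u} [Field K] {G : Type v} [Group G]
    [AffineVariety K G] [IsAffineAlgebraicGroup K G] {H : Subgroup G} (g : G)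
    (f : rightInvariants K H) : leftTranslate K g (leftTranslate K g⁻¹ f) = f := by
  apply Subtype.ext
  apply Subtype.ext
  funext x
  simp [leftTranslate_apply]

theorem boundaryIdeal_isLeftInvariant {K : Type u} [Field K] [IsAlgClosed K] {G : Type v}
    [Group G] [AffineVariety K G] [IsAffineAlgebraicGroup K G] {H : Subgroup G}
    (hH : IsObservable K H) : IsLeftInvariant K (boundaryIdeal K H hH) := by
  intro g
  -- the translate by `g⁻¹` of the boundary ideal is a radical ideal without common zeros
  refine boundaryIdeal_le_of_isRadical hH
    (I := (boundaryIdeal K H hH).comap (leftTranslateHom g))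
    ((boundaryIdeal_isRadical hH).comap _) fun x => ?_
  obtain ⟨c, hc, hx⟩ := exists_mem_boundaryIdeal_apply_ne_zero hH (g * x)
  refine ⟨leftTranslate K g⁻¹ c, ?_, ?_⟩
  · change leftTranslate K g (leftTranslate K g⁻¹ c) ∈ boundaryIdeal K H hH
    rwa [leftTranslate_leftTranslate_inv]
  · rwa [leftTranslate_apply, inv_inv]

/-- Transitivity of the action on `G/H`: a nonzero invariant ideal has no common zeros. -/
theorem IsLeftInvariant.exists_mem_apply_ne_zero {K : Type u} [Field K] {G : Type v} [Group G]
    [AffineVariety K G] [IsAffineAlgebraicGroup K G] {H : Subgroup G}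
    {I : Ideal (rightInvariants K H)} (hI : IsLeftInvariant K I) (hne : I ≠ ⊥) (x : G) :
    ∃ c ∈ I, (c : G → K) x ≠ 0 := by
  obtain ⟨f, hf, hf0⟩ := Submodule.exists_mem_ne_zero_of_ne_bot hne
  have hy : ∃ y, (f : G → K) y ≠ 0 := by
    by_contra! hc
    exact hf0 (Subtype.ext (Subtype.ext (funext hc)))
  obtain ⟨y, hy⟩ := hy
  refine ⟨leftTranslate K (x * y⁻¹) f, hI _ f hf, ?_⟩
  simpa [leftTranslate_apply] using hy

end AlgebraicGroup

theorem mainTheorem2 {K : Type u} [Field K] [IsAlgClosed K]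
    {G : Type v} [Group G] [AffineVariety K G] [IsAffineAlgebraicGroup K G]
    (H : Subgroup G) (hH : AlgebraicGroup.IsObservable K H) :
    (∀ (X : Type w) [AffineVariety K X] (φ : G ⧸ H → X)
        (hφ : (AlgebraicGroup.cosetSpace K H).IsAffineEmbedding φ),
        AlgebraicGroup.boundaryIdeal K H hH =
          ((AffineVariety.vanishingIdeal K (Set.range φ)ᶜ).map
            (AlgebraicGroup.pullback K H hφ)).radical) ∧
      IsLeast {I : Ideal (AlgebraicGroup.rightInvariants K H) |
          I ≠ ⊥ ∧ I.IsRadical ∧ AlgebraicGroup.IsLeftInvariant K I}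
        (AlgebraicGroup.boundaryIdeal K H hH) := by
  refine ⟨fun X _ φ hφ => AlgebraicGroup.boundaryIdeal_eq_radical hH hφ, ⟨?_, ?_, ?_⟩, ?_⟩
  · intro hbot
    obtain ⟨c, hc, hc1⟩ := AlgebraicGroup.exists_mem_boundaryIdeal_apply_ne_zero hH 1
    rw [hbot, Ideal.mem_bot] at hc
    exact hc1 (by rw [hc]; rfl)
  · exact AlgebraicGroup.boundaryIdeal_isRadical hH
  · exact AlgebraicGroup.boundaryIdeal_isLeftInvariant hH
  · rintro I ⟨hne, hrad, hinv⟩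
    exact AlgebraicGroup.boundaryIdeal_le_of_isRadical hH hrad
      (hinv.exists_mem_apply_ne_zero hne)
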